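/- Let $\mathcal Q$ be a small quantaloid, i.e. a small category whose hom-sets are complete lattices and whose composition preserves arbitrary joins in each variable. A small $\mathcal Q$-category $(X,a)$ consists of a set $X$, an object $|x|$ of $\mathcal Q$ for every $x\in X$, and morphisms $a(x,y):|x|\to|y|$ in $\mathcal Q$ $(x,y\in X)$ with $1_{|x|}\le a(x,x)$ and $a(y,z)\circ a(x,y)\le a(x,z)$ for all $x,y,z\in X$. A $\mathcal Q$-functor $f:(X,a)\to(Y,b)$ is a map $f:X\to Y$ with $|x|=|f(x)|$ and $a(x,y)\le b(f(x),f(y))$ for all $x,y\in X$. Let $\mathcal Q\text{-}\mathbf{Cat}$ be the (ordinary) category of small $\mathcal Q$-categories and $\mathcal Q$-functors. A category $\mathcal C$ with small hom-sets is called - totally cocomplete, if every diagram $D:\mathcal J\to\mathcal C$ (with $\mathcal J$ of arbitrary size) has a colimit in $\mathcal C$ whenever the colimit of $\mathcal C(A,D-)$ exists in $\mathbf{Set}$ for all objects $A$ of $\mathcal C$; - hypercomplete, if every diagram $D:\mathcal J\to\mathcal C$ (with $\mathcal J$ of arbitrary size) has a limit in $\mathcal C$ whenever the limit of $\mathcal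 C(A,D-)$ exists in $\mathbf{Set}$ for all objects $A$ of $\mathcal C$; - totally complete, respectively hypercocomplete, if $\mathcal C^{\mathrm{op}}$ is totally cocomplete, respectively hypercomplete. **Theorem.** For every small quantaloid $\mathcal Q$, the category $\mathcal Q\text{-}\mathbf{Cat}$ is totally complete and totally cocomplete and, in particular, hypercocomplete and hypercomplete. -/

import Mathlib

open CategoryTheory CategoryTheory.Limits Opposite

universe w₁ w₂ v u

/-- A quantaloid: a category enriched in complete lattices and sup-preserving maps, i.e. every
hom-set is a complete lattice and composition preserves arbitrary joins in each variable.
It is small when both universe levels agree. -/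
class Quantaloid (Q : Type u) extends Category.{v} Q where
  homLattice (p q : Q) : CompleteLattice (p ⟶ q)
  sSup_comp {p q r : Q} (S : Set (p ⟶ q)) (g : q ⟶ r) : sSup S ≫ g = ⨆ f ∈ S, f ≫ g
  comp_sSup {p q r : Q} (f : p ⟶ q) (S : Set (q ⟶ r)) : f ≫ sSup S = ⨆ g ∈ S, f ≫ g

attribute [reducible, instance] Quantaloid.homLattice

/-- A small `Q`-category: a set of objects, each with an extent in `Q`, and hom-arrows in `Q`
between the extents. (`f ≫ g` is composition in diagrammatic order, i.e. `g ∘ f`.) -/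
structure QCat (Q : Type u) [Quantaloid.{u, u} Q] where
  carrier : Type u
  extent : carrier → Q
  arrow (x y : carrier) : extent x ⟶ extent y
  id_le (x : carrier) : 𝟙 (extent x) ≤ arrow x x
  comp_le (x y z : carrier) : arrow x y ≫ arrow y z ≤ arrow x z

namespace QCat

variable {Q : Type u} [Quantaloid.{u, u} Q]

/-- A `Q`-functor: an extent-preserving map `f` with `a (x, y) ≤ b (f x, f y)`. The arrows
`eqToHom _` are the identities of `Q` that identify equal extents. -/
@[ext]
structure QFunctor (X Y : QCat Q) where
  toFun : X.carrier → Y.carrier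
  extent_eq (x : X.carrier) : X.extent x = Y.extent (toFun x)
  arrow_le (x y : X.carrier) :
    X.arrow x y ≤
      eqToHom (extent_eq x) ≫ Y.arrow (toFun x) (toFun y) ≫ eqToHom (extent_eq y).symm

theorem comp_le_comp_left {p q r : Q} (f : p ⟶ q) {g h : q ⟶ r} (hgh : g ≤ h) :
    f ≫ g ≤ f ≫ h := by
  have e : h = sSup {g, h} := by rw [sSup_pair]; exact (sup_eq_right.mpr hgh).symm
  rw [e, Quantaloid.comp_sSup]
  exact le_iSup₂_of_le g (by simp) le_rfl

theorem comp_le_comp_right {p q r : Q} {f g : p ⟶ q} (hfg : f ≤ g) (h : q ⟶ r) :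
    f ≫ h ≤ g ≫ h := by
  have e : g = sSup {f, g} := by rw [sSup_pair]; exact (sup_eq_right.mpr hfg).symm
  rw [e, Quantaloid.sSup_comp]
  exact le_iSup₂_of_le f (by simp) le_rfl

/-- The identity `Q`-functor. -/
def QFunctor.id (X : QCat Q) : QFunctor X X where
  toFun x := x
  extent_eq _ := rfl
  arrow_le x y := by simp

/-- Composition of `Q`-functors is composition of the underlying maps. -/
def QFunctor.comp {X Y Z : QCat Q} (f : QFunctor X Y) (g : QFunctor Y Z) : QFunctor X Z where
  toFun x := g.toFun (f.toFun x)
  extent_eq x := (f.extent_eq x).trans (g.extent_eq (f.toFun x))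
  arrow_le x y := by
    refine (f.arrow_le x y).trans ?_
    have h := comp_le_comp_left (eqToHom (f.extent_eq x))
      (comp_le_comp_right (g.arrow_le (f.toFun x) (f.toFun y)) (eqToHom (f.extent_eq y).symm))
    simpa using h

/-- The category of small `Q`-categories and `Q`-functors. -/
instance : Category.{u} (QCat Q) where
  Hom X Y := QFunctor X Y
  id X := QFunctor.id X
  comp f g := QFunctor.comp f g

end QCat

section Totality

variable (C : Type u) [Category.{v} C]

/-- `C` is hypercomplete (for diagrams over categories `J` in the given universes, which may be
arbitrarily large): `D : J ⥤ C` has a limit whenever the limit of `C(A, D-)` exists in the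
category of (small) sets for all objects `A`. -/
def IsHypercomplete : Prop :=
  ∀ (J : Type w₁) [Category.{w₂} J] (D : J ⥤ C),
    (∀ A : C, HasLimit (D ⋙ coyoneda.obj (op A))) → HasLimit D

/-- `C` is totally cocomplete: `D : J ⥤ C` has a colimit whenever the colimit of `C(A, D-)`
exists in the category of (small) sets for all objects `A`. -/
def IsTotallyCocomplete : Prop :=
  ∀ (J : Type w₁) [Category.{w₂} J] (D : J ⥤ C),
    (∀ A : C, HasColimit (D ⋙ coyoneda.obj (op A))) → HasColimit D

/-- `C` is hypercocomplete, the dual of hypercomplete: `D : J ⥤ C` has a colimit whenever the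
limit of `C(D-, A)` exists in the category of (small) sets for all objects `A`. -/
def IsHypercocomplete : Prop :=
  ∀ (J : Type w₁) [Category.{w₂} J] (D : J ⥤ C),
    (∀ A : C, HasLimit (D.op ⋙ yoneda.obj A)) → HasColimit D

/-- `C` is totally complete, the dual of totally cocomplete: `D : J ⥤ C` has a limit whenever the
colimit of `C(D-, A)` exists in the category of (small) sets for all objects `A`. -/
def IsTotallyComplete : Prop :=
  ∀ (J : Type w₁) [Category.{w₂} J] (D : J ⥤ C),
    (∀ A : C, HasColimit (D.op ⋙ yoneda.obj A)) → HasLimit D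

end Totality

/-!
Sending a `Q`-category to the fibers of its extent map is a topological functor to families of sets
indexed by the objects of `Q`: the meet of the pulled back hom-arrows is an initial structure, for
sources of any size. A topological functor has both adjoints and lifts limits and colimits, and a
functor with a left adjoint that lifts colimits transfers total cocompleteness from its codomain to
its domain: if the colimits of `C(A, D-)` exist for all `A`, then so do those of
`C(L b, D-) ≅ B(b, U D-)`, for `L` the left adjoint of `U`. The same argument, applied to the
evaluations, passes from sets to families of sets, and the dual one treats total completeness.

A presheaf on a totally cocomplete category `C` is a colimit of representables, pointwise in sets,
so the corresponding colimit exists in `C` and is a reflection of it. Thus `C` is reflective in its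
presheaves, where limits are pointwise, and this makes `C` hypercomplete.
-/

section Totality

variable {C : Type u} [Category.{v} C]

theorem hasInitial_structuredArrow_of_isColimit {E : Type*} [Category* E] (R : C ⥤ E) [R.Full]
    [R.Faithful] {J : Type*} [Category* J] (D : J ⥤ C) [HasColimit D] {c : Cocone (D ⋙ R)}
    (hc : IsColimit c) : HasInitial (StructuredArrow c.pt R) := by
  let unit : c.pt ⟶ R.obj (colimit D) := hc.desc (R.mapCocone (colimit.cocone D))
  have ι_unit (j : J) : c.ι.app j ≫ unit = R.map (colimit.ι D j) := hc.fac _ j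
  let cocone (f : StructuredArrow c.pt R) : Cocone D :=
    { pt := f.right
      ι :=
        { app j := R.preimage (c.ι.app j ≫ f.hom)
          naturality i j g := R.map_injective <| by simpa using c.w_assoc g f.hom } }
  refine (IsInitial.ofUniqueHom (X := StructuredArrow.mk unit)
    (fun f => StructuredArrow.homMk (colimit.desc D (cocone f)) ?_) fun f g => ?_).hasInitial
  · refine hc.hom_ext fun j => ?_
    calc c.ι.app j ≫ unit ≫ R.map (colimit.desc D (cocone f))
      _ = R.map (colimit.ι D j ≫ colimit.desc D (cocone f)) := by
        rw [R.map_comp, ← ι_unit, Category.assoc]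
      _ = c.ι.app j ≫ f.hom := by rw [colimit.ι_desc, R.map_preimage]
  · refine StructuredArrow.hom_ext _ _ (colimit.hom_ext fun j => R.map_injective ?_)
    calc R.map (colimit.ι D j ≫ g.right)
      _ = c.ι.app j ≫ unit ≫ R.map g.right := by rw [R.map_comp, ← ι_unit, Category.assoc]
      _ = c.ι.app j ≫ f.hom := by rw [← StructuredArrow.w g]; rfl
      _ = R.map (colimit.ι D j ≫ colimit.desc D (cocone f)) := by
        rw [colimit.ι_desc, R.map_preimage]

theorem IsTotallyCocomplete.hasColimit_proj_yoneda
    (hC : IsTotallyCocomplete.{max u v, v} C) (P : Cᵒᵖ ⥤ Type v) :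
    HasColimit (CostructuredArrow.proj yoneda P) :=
  hC _ _ fun A => ⟨⟨_, isColimitOfPreserves ((evaluation Cᵒᵖ (Type v)).obj (op A))
    (Presheaf.isColimitTautologicalCocone P)⟩⟩

theorem IsTotallyCocomplete.isRightAdjoint_yoneda (hC : IsTotallyCocomplete.{max u v, v} C) :
    (yoneda (C := C)).IsRightAdjoint :=
  isRightAdjoint_iff_hasInitial_structuredArrow.mpr fun P =>
    have := hC.hasColimit_proj_yoneda P
    hasInitial_structuredArrow_of_isColimit yoneda _ (Presheaf.isColimitTautologicalCocone P)

theorem IsTotallyCocomplete.isHypercomplete (hC : IsTotallyCocomplete.{max u v, v} C) :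
    IsHypercomplete.{w₁, w₂} C := by
  intro J _ D hD
  have := hC.isRightAdjoint_yoneda
  have (A : Cᵒᵖ) : HasLimit ((D ⋙ yoneda).flip.obj A) := hD A.unop
  let : Reflective (yoneda (C := C)) := { L := _, adj := Adjunction.ofIsRightAdjoint yoneda }
  exact hasLimit_of_reflective D yoneda

theorem IsTotallyComplete.isTotallyCocomplete_op (hC : IsTotallyComplete.{w₁, w₂} C) :
    IsTotallyCocomplete.{w₁, w₂} Cᵒᵖ := by
  intro J _ D hD
  suffices HasLimit D.leftOp from hasColimit_of_hasLimit_leftOp D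
  refine hC _ _ fun A => ?_
  have := hD (op A)
  have : HasColimit ((opOpEquivalence J).symm.functor ⋙ D.leftOp.op ⋙ yoneda.obj A) :=
    hasColimit_of_iso (G := D ⋙ yoneda.obj A)
      (Functor.isoWhiskerLeft D (Coyoneda.objOpOp A).symm)
  exact hasColimit_of_equivalence_comp (opOpEquivalence J).symm

theorem IsHypercomplete.isHypercocomplete_unop (hC : IsHypercomplete.{w₁, w₂} Cᵒᵖ) :
    IsHypercocomplete.{w₁, w₂} C := by
  intro J _ D hD
  suffices HasLimit D.op from hasColimit_of_hasLimit_op D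
  refine hC _ _ fun A => ?_
  have := hD A.unop
  exact hasLimit_of_iso (Functor.isoWhiskerLeft D.op (Coyoneda.objOpOp A.unop).symm)

theorem IsTotallyComplete.isHypercocomplete (hC : IsTotallyComplete.{max u v, v} C) :
    IsHypercocomplete.{w₁, w₂} C :=
  hC.isTotallyCocomplete_op.isHypercomplete.isHypercocomplete_unop

variable {ι : Type*} {B : ι → Type*} [∀ i, Category.{v} (B i)] (U : ∀ i, C ⥤ B i)

theorem IsTotallyCocomplete.of_jointly_lifts_colimits [∀ i, (U i).IsRightAdjoint]
    (hU : ∀ (J : Type w₁) [Category.{w₂} J] (D : J ⥤ C),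
      (∀ i, HasColimit (D ⋙ U i)) → HasColimit D)
    (hB : ∀ i, IsTotallyCocomplete.{w₁, w₂} (B i)) : IsTotallyCocomplete.{w₁, w₂} C :=
  fun J _ D hD => hU J D fun i => hB i J (D ⋙ U i) fun b =>
    have := hD ((U i).leftAdjoint.obj b)
    hasColimit_of_iso (Functor.isoWhiskerLeft D
      ((Adjunction.ofIsRightAdjoint (U i)).compCoyonedaIso.app (op b)).symm)

theorem IsTotallyComplete.of_jointly_lifts_limits [∀ i, (U i).IsLeftAdjoint]
    (hU : ∀ (J : Type w₁) [Category.{w₂} J] (D : J ⥤ C), (∀ i, HasLimit (D ⋙ U i)) → HasLimit D)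
    (hB : ∀ i, IsTotallyComplete.{w₁, w₂} (B i)) : IsTotallyComplete.{w₁, w₂} C :=
  fun J _ D hD => hU J D fun i => hB i J (D ⋙ U i) fun b =>
    have := hD ((U i).rightAdjoint.obj b)
    hasColimit_of_iso (F := D.op ⋙ yoneda.obj ((U i).rightAdjoint.obj b))
      (Functor.isoWhiskerLeft D.op
        ((Adjunction.ofIsLeftAdjoint (U i)).compYonedaIso.app b).symm)

end Totality

theorem isTotallyCocomplete_type : IsTotallyCocomplete.{w₁, w₂} (Type u) := fun _ _ D hD =>
  have := hD PUnit
  hasColimit_of_iso (Functor.isoWhiskerLeft D Coyoneda.punitIso.symm)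

theorem isTotallyComplete_type : IsTotallyComplete.{w₁, w₂} (Type u) := by
  -- A section of `D` can be recovered from the values of predicates on `D` along it, and these
  -- values only depend on the class of the predicate in the colimit of `D(-) → Prop`.
  intro J _ D hD
  let F := D.op ⋙ yoneda.obj (ULift.{u} Prop)
  let eval (x : D.sections) : F.ColimitType → Prop :=
    F.descColimitType
      { pt := Prop
        ι j := fun P : D.obj j.unop ⟶ ULift.{u} Prop => (P (x.1 j.unop)).down
        ι_naturality k := funext fun P : D.obj _ ⟶ ULift.{u} Prop =>
          congrArg (fun y => (P y).down) (x.2 k.unop) }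
  have : Small.{u} F.ColimitType := (Types.hasColimit_iff_small_colimitType F).mp (hD _)
  suffices eval.Injective from
    (Types.hasLimit_iff_small_sections D).mpr (small_of_injective this)
  intro x y hxy
  ext j
  let eqToY : D.obj j ⟶ ULift.{u} Prop := ↾fun z => ⟨z = y.1 j⟩
  have : (x.1 j = y.1 j) = (y.1 j = y.1 j) := congrFun hxy (F.ιColimitType (op j) eqToY)
  exact this.mpr rfl

section FunctorCategory

variable {K : Type v} [Category* K] {C : Type u} [Category.{v} C]

theorem IsTotallyCocomplete.functor [∀ k l : K, HasCoproductsOfShape (k ⟶ l) C]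
    (hC : IsTotallyCocomplete.{w₁, w₂} C) : IsTotallyCocomplete.{w₁, w₂} (K ⥤ C) :=
  .of_jointly_lifts_colimits (fun k => (evaluation K C).obj k)
    (fun _ _ D (_ : ∀ k, HasColimit (D.flip.obj k)) => inferInstance) fun _ => hC

theorem IsTotallyComplete.functor [∀ k l : K, HasProductsOfShape (k ⟶ l) C]
    (hC : IsTotallyComplete.{w₁, w₂} C) : IsTotallyComplete.{w₁, w₂} (K ⥤ C) :=
  .of_jointly_lifts_limits (fun k => (evaluation K C).obj k)
    (fun _ _ D (_ : ∀ k, HasLimit (D.flip.obj k)) => inferInstance) fun _ => hC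

end FunctorCategory

section TopologicalFunctor

variable {C : Type*} [Category* C] {B : Type*} [Category* B]

/-- An initial lift of a source `S` of structured arrows on `b`: a morphism of `B` into `b` lifts to
`obj` exactly when its composites with the members of `S` lift to their codomains. As `S` is a set
of structured arrows, it may be as large as `C` and involves no index universe; as equality of
objects is not a sensible condition, `obj` lies over `b` only up to `iso`. -/
structure InitialLift (U : C ⥤ B) {b : B} (S : Set (StructuredArrow b U)) where
  obj : C
  iso : U.obj obj ≅ b
  exists_map_eq_iff {A : C} (g : U.obj A ⟶ b) :
    (∃ h : A ⟶ obj, U.map h = g ≫ iso.inv) ↔ ∀ f ∈ S, ∃ k : A ⟶ f.right, U.map k = g ≫ f.hom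

namespace InitialLift

variable {U : C ⥤ B} {b : B} {S : Set (StructuredArrow b U)} (L : InitialLift U S)

theorem exists_map_comp_eq {A : C} {g : U.obj A ⟶ b}
    (hg : ∀ f ∈ S, ∃ k : A ⟶ f.right, U.map k = g ≫ f.hom) :
    ∃ h : A ⟶ L.obj, U.map h ≫ L.iso.hom = g :=
  (L.exists_map_eq_iff g).mpr hg |>.imp fun _ hh => by rw [hh, Category.assoc, L.iso.inv_hom_id,
    Category.comp_id]

theorem exists_map_eq_comp {f : StructuredArrow b U} (hf : f ∈ S) :
    ∃ k : L.obj ⟶ f.right, U.map k = L.iso.hom ≫ f.hom :=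
  (L.exists_map_eq_iff L.iso.hom).mp ⟨𝟙 _, by simp⟩ f hf

end InitialLift

/-- A topological functor: a faithful functor along which every source, small or not, has an initial
lift. -/
class IsTopologicalFunctor (U : C ⥤ B) : Prop extends U.Faithful where
  nonempty_initialLift {b : B} (S : Set (StructuredArrow b U)) : Nonempty (InitialLift U S)

namespace IsTopologicalFunctor

variable (U : C ⥤ B) [IsTopologicalFunctor U]

instance isLeftAdjoint : U.IsLeftAdjoint := by
  refine isLeftAdjoint_iff_hasTerminal_costructuredArrow.mpr fun b => ?_
  obtain ⟨indiscrete⟩ := nonempty_initialLift (U := U) (b := b) ∅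
  have hlift (f : CostructuredArrow U b) :
      ∃ h : f.left ⟶ indiscrete.obj, U.map h ≫ indiscrete.iso.hom = f.hom :=
    indiscrete.exists_map_comp_eq (by simp)
  choose lift hlift using hlift
  refine (IsTerminal.ofUniqueHom (Y := CostructuredArrow.mk indiscrete.iso.hom)
    (fun f => CostructuredArrow.homMk (lift f) (hlift f)) fun f g => ?_).hasTerminal
  refine CostructuredArrow.hom_ext _ _ (U.map_injective ?_)
  exact (cancel_mono indiscrete.iso.hom).mp ((CostructuredArrow.w g).trans (hlift f).symm)

instance isRightAdjoint : U.IsRightAdjoint := by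
  refine isRightAdjoint_iff_hasInitial_structuredArrow.mpr fun b => ?_
  obtain ⟨discrete⟩ := nonempty_initialLift (U := U) (b := b) Set.univ
  choose desc hdesc using fun f : StructuredArrow b U =>
    discrete.exists_map_eq_comp (Set.mem_univ f)
  refine (IsInitial.ofUniqueHom (X := StructuredArrow.mk discrete.iso.inv)
    (fun f => StructuredArrow.homMk (desc f) ?_) fun f g => ?_).hasInitial
  · exact (Iso.inv_comp_eq _).mpr (hdesc f)
  · refine StructuredArrow.hom_ext _ _ (U.map_injective ?_)
    exact ((Iso.inv_comp_eq _).mp (StructuredArrow.w g)).trans (hdesc f).symm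

variable {J : Type*} [Category* J] (D : J ⥤ C)

theorem hasLimit_of_hasLimit_comp [HasLimit (D ⋙ U)] : HasLimit D := by
  obtain ⟨L⟩ := nonempty_initialLift
    (Set.range fun j => StructuredArrow.mk (T := U) (limit.π (D ⋙ U) j))
  choose π hπ using fun j => L.exists_map_eq_comp (Set.mem_range_self j)
  let c : Cone D :=
    { pt := L.obj
      π :=
        { app := π
          naturality i j f := U.map_injective <| by
            simpa [hπ] using (limit.w (D ⋙ U) f).symm } }
  have hlift (s : Cone D) :
      ∃ h : s.pt ⟶ L.obj, U.map h ≫ L.iso.hom = limit.lift (D ⋙ U) (U.mapCone s) :=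
    L.exists_map_comp_eq <| Set.forall_mem_range.mpr fun j => ⟨s.π.app j, by simp⟩
  choose lift hlift using hlift
  refine ⟨⟨c, ⟨lift, fun s j => U.map_injective ?_, fun s m hm => U.map_injective ?_⟩⟩⟩
  · simp [c, hπ, reassoc_of% hlift]
  · refine (cancel_mono L.iso.hom).mp (limit.hom_ext fun j => ?_)
    simp [c, ← hm, hπ, hlift]

theorem hasColimit_of_hasColimit_comp [HasColimit (D ⋙ U)] : HasColimit D := by
  -- The final structure is initial for all maps whose composites with the coprojections lift.
  obtain ⟨L⟩ := nonempty_initialLift {f : StructuredArrow (colimit (D ⋙ U)) U |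
    ∀ j, ∃ k : D.obj j ⟶ f.right, U.map k = colimit.ι (D ⋙ U) j ≫ f.hom}
  choose ι hι using fun j => L.exists_map_comp_eq fun f hf => hf j
  let c : Cocone D :=
    { pt := L.obj
      ι :=
        { app := ι
          naturality i j f := U.map_injective <| (cancel_mono L.iso.hom).mp <| by
            simpa [hι] using colimit.w (D ⋙ U) f } }
  have hdesc (s : Cocone D) :
      ∃ k : L.obj ⟶ s.pt, U.map k = L.iso.hom ≫ colimit.desc (D ⋙ U) (U.mapCocone s) :=
    L.exists_map_eq_comp (f := StructuredArrow.mk (colimit.desc (D ⋙ U) (U.mapCocone s)))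
      fun j => ⟨s.ι.app j, by simp⟩
  choose desc hdesc using hdesc
  refine ⟨⟨c, ⟨desc, fun s j => U.map_injective ?_, fun s m hm => U.map_injective ?_⟩⟩⟩
  · simp [c, reassoc_of% hι, hdesc]
  · refine (cancel_epi L.iso.inv).mp (colimit.hom_ext fun j => ?_)
    calc colimit.ι (D ⋙ U) j ≫ L.iso.inv ≫ U.map m
      _ = U.map (ι j ≫ m) := by simp [← reassoc_of% hι]
      _ = U.map (s.ι.app j) := congrArg U.map (hm j)
      _ = colimit.ι (D ⋙ U) j ≫ L.iso.inv ≫ U.map (desc s) := by simp [hdesc]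

end IsTopologicalFunctor

variable {C : Type*} [Category.{v} C] {B : Type*} [Category.{v} B]

theorem IsTotallyCocomplete.of_isTopologicalFunctor (U : C ⥤ B) [IsTopologicalFunctor U]
    (hB : IsTotallyCocomplete.{w₁, w₂} B) : IsTotallyCocomplete.{w₁, w₂} C :=
  .of_jointly_lifts_colimits (fun _ : Unit => U)
    (fun _ _ D hD =>
      have := hD ()
      IsTopologicalFunctor.hasColimit_of_hasColimit_comp U D)
    fun _ => hB

theorem IsTotallyComplete.of_isTopologicalFunctor (U : C ⥤ B) [IsTopologicalFunctor U]
    (hB : IsTotallyComplete.{w₁, w₂} B) : IsTotallyComplete.{w₁, w₂} C :=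
  .of_jointly_lifts_limits (fun _ : Unit => U)
    (fun _ _ D hD =>
      have := hD ()
      IsTopologicalFunctor.hasLimit_of_hasLimit_comp U D)
    fun _ => hB

end TopologicalFunctor

namespace QCat

variable {Q : Type u} [Quantaloid.{u, u} Q]

/-- The elements of `X` of extent `q`. -/
def Fiber (X : QCat Q) (q : Q) : Type u := {x : X.carrier // X.extent x = q}

namespace Fiber

variable {X : QCat Q} {p q r : Q}

/-- The hom-arrow of `X` between elements of fibers, transported to the base points so that elements
whose extents are only propositionally equal can be compared. -/
def arrow (x : X.Fiber p) (y : X.Fiber q) : p ⟶ q :=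
  eqToHom x.2.symm ≫ X.arrow x.1 y.1 ≫ eqToHom y.2

theorem arrow_mk_rfl (x y : X.carrier) :
    arrow (⟨x, rfl⟩ : X.Fiber _) (⟨y, rfl⟩ : X.Fiber _) = X.arrow x y := by
  simp [arrow]

theorem id_le_arrow (x : X.Fiber p) : 𝟙 p ≤ x.arrow x := by
  obtain ⟨x, rfl⟩ := x
  exact (X.id_le x).trans_eq (arrow_mk_rfl x x).symm

theorem arrow_comp_arrow_le (x : X.Fiber p) (y : X.Fiber q) (z : X.Fiber r) :
    x.arrow y ≫ y.arrow z ≤ x.arrow z := by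
  obtain ⟨x, rfl⟩ := x
  obtain ⟨y, rfl⟩ := y
  obtain ⟨z, rfl⟩ := z
  simpa only [arrow_mk_rfl] using X.comp_le x y z

end Fiber

/-- The forgetful functor to families of sets indexed by the objects of `Q`, sending a `Q`-category
to the fibers of its extent map. The category of families is encoded as functors on `Discrete Q`. -/
def fiberFunctor (Q : Type u) [Quantaloid.{u, u} Q] : QCat Q ⥤ Discrete Q ⥤ Type u where
  obj X := Discrete.functor X.Fiber
  map f := Discrete.natTrans fun ⟨_⟩ =>
    ↾fun x => ⟨QFunctor.toFun f x.1, (QFunctor.extent_eq f x.1).symm.trans x.2⟩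

instance : (fiberFunctor Q).Faithful where
  map_injective {X Y f g} h := QFunctor.ext <| funext fun x => by
    exact congrArg Subtype.val (congrArg (fun k => k.app ⟨X.extent x⟩ ⟨x, rfl⟩) h)

theorem exists_fiberFunctor_map_eq_iff {X Y : QCat Q}
    (g : (fiberFunctor Q).obj X ⟶ (fiberFunctor Q).obj Y) :
    (∃ f : X ⟶ Y, (fiberFunctor Q).map f = g) ↔ ∀ (p q : Q) (x : X.Fiber p) (y : X.Fiber q),
      x.arrow y ≤ Fiber.arrow (X := Y) (g.app ⟨p⟩ x) (g.app ⟨q⟩ y) := by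
  constructor
  · rintro ⟨f, rfl⟩ _ _ ⟨x, rfl⟩ ⟨y, rfl⟩
    exact (Fiber.arrow_mk_rfl x y).trans_le (QFunctor.arrow_le f x y)
  · intro hg
    let image (x : X.carrier) : Y.Fiber (X.extent x) := g.app ⟨X.extent x⟩ ⟨x, rfl⟩
    let f : QFunctor X Y :=
      { toFun x := (image x).1
        extent_eq x := (image x).2.symm
        arrow_le x y := (Fiber.arrow_mk_rfl x y).ge.trans (hg _ _ ⟨x, rfl⟩ ⟨y, rfl⟩) }
    refine ⟨f, ?_⟩
    ext ⟨q⟩ (x : X.Fiber q)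
    obtain ⟨x, rfl⟩ := x
    rfl

section InitialStructure

variable {b : Discrete Q ⥤ Type u} (S : Set (StructuredArrow b (fiberFunctor Q)))

/-- The largest `Q`-category structure on the family `b` for which all maps in `S` are
`Q`-functors: its hom-arrows are the meets of those of the codomains. -/
def initialStructure : QCat Q where
  carrier := Σ q : Q, b.obj ⟨q⟩
  extent := Sigma.fst
  arrow := fun ⟨p, x⟩ ⟨q, y⟩ => ⨅ f : S,
    Fiber.arrow (X := f.1.right) (f.1.hom.app ⟨p⟩ x) (f.1.hom.app ⟨q⟩ y)
  id_le _ := le_iInf fun _ => Fiber.id_le_arrow _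
  comp_le _ _ _ := le_iInf fun f =>
    (comp_le_comp_left _ (iInf_le _ f)).trans <|
      (comp_le_comp_right (iInf_le _ f) _).trans <| Fiber.arrow_comp_arrow_le _ _ _

/-- The underlying family of `initialStructure S` is `b`. -/
def fiberInitialStructureIso : (fiberFunctor Q).obj (initialStructure S) ≅ b :=
  Discrete.natIso fun q => (Equiv.sigmaSubtype (β := fun q : Q => b.obj ⟨q⟩) q.as).toIso

theorem arrow_fiberInitialStructureIso_inv {p q : Q} (x : b.obj ⟨p⟩) (y : b.obj ⟨q⟩) :
    Fiber.arrow (X := initialStructure S) ((fiberInitialStructureIso S).inv.app ⟨p⟩ x)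
        ((fiberInitialStructureIso S).inv.app ⟨q⟩ y) =
      ⨅ f : S, Fiber.arrow (X := f.1.right) (f.1.hom.app ⟨p⟩ x) (f.1.hom.app ⟨q⟩ y) :=
  (Category.id_comp _).trans (Category.comp_id _)

/-- `initialStructure S` as an initial lift of `S` along `fiberFunctor Q`. -/
def initialLift : InitialLift (fiberFunctor Q) S where
  obj := initialStructure S
  iso := fiberInitialStructureIso S
  exists_map_eq_iff {A} g :=
    calc (∃ h : A ⟶ initialStructure S,
          (fiberFunctor Q).map h = g ≫ (fiberInitialStructureIso S).inv)
      _ ↔ ∀ (p q : Q) (x : A.Fiber p) (y : A.Fiber q), x.arrow y ≤ ⨅ f : S,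
          Fiber.arrow (X := f.1.right) ((g ≫ f.1.hom).app ⟨p⟩ x) ((g ≫ f.1.hom).app ⟨q⟩ y) :=
        (exists_fiberFunctor_map_eq_iff _).trans <| forall₄_congr fun p q x y =>
          iff_of_eq (congrArg _ (arrow_fiberInitialStructureIso_inv S _ _))
      _ ↔ ∀ f ∈ S, ∀ (p q : Q) (x : A.Fiber p) (y : A.Fiber q), x.arrow y ≤
          Fiber.arrow (X := f.right) ((g ≫ f.hom).app ⟨p⟩ x) ((g ≫ f.hom).app ⟨q⟩ y) := by
        simp only [le_iInf_iff, Subtype.forall]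
        exact ⟨fun h f hf p q x y => h p q x y f hf, fun h p q x y f hf => h f hf p q x y⟩
      _ ↔ ∀ f ∈ S, ∃ k : A ⟶ f.right, (fiberFunctor Q).map k = g ≫ f.hom :=
        forall₂_congr fun _ _ => (exists_fiberFunctor_map_eq_iff _).symm

end InitialStructure

instance : IsTopologicalFunctor (fiberFunctor Q) where
  nonempty_initialLift S := ⟨initialLift S⟩

variable (Q)

theorem isTotallyCocomplete : IsTotallyCocomplete.{w₁, w₂} (QCat Q) :=
  .of_isTopologicalFunctor (fiberFunctor Q) isTotallyCocomplete_type.functor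

theorem isTotallyComplete : IsTotallyComplete.{w₁, w₂} (QCat Q) :=
  .of_isTopologicalFunctor (fiberFunctor Q) isTotallyComplete_type.functor

end QCat

theorem mainTheorem2 (Q : Type u) [Quantaloid.{u, u} Q] :
    IsTotallyComplete.{w₁, w₂} (QCat Q) ∧
    IsTotallyCocomplete.{w₁, w₂} (QCat Q) ∧
    IsHypercocomplete.{w₁, w₂} (QCat Q) ∧
    IsHypercomplete.{w₁, w₂} (QCat Q) :=
  ⟨QCat.isTotallyComplete Q, QCat.isTotallyCocomplete Q,
    (QCat.isTotallyComplete Q).isHypercocomplete, (QCat.isTotallyCocomplete Q).isHypercomplete⟩
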